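/- For $d\ge 1$ and $k\ge 0$ let $\mathcal P^k=\mathcal P^k(\mathbb C^d)$ be the set of states on $(\mathbb C^d)^{\otimes k}$ of the form $\int\sigma^{\otimes k}\,dm(\sigma)$, where $m$ is a probability measure on the set of density matrices $\sigma$ on $\mathbb C^d$. Let $\mathrm{Sym}^n(\mathbb C^2)\subset(\mathbb C^2)^{\otimes n}$ be the subspace of vectors fixed by all permutations of the $n$ tensor factors. Distances between operators are measured by the trace distance $\|A-B\|=\tfrac12\operatorname{tr}|A-B|$, and the distance of $\xi$ to $\mathcal P^k$ is $\inf_{\tau\in\mathcal P^k}\|\xi-\tau\|$. Theorem. For every $n$ there is a unit vector $|\Psi_n\rangle\in\mathrm{Sym}^n(\mathbb C^2)$ such that, for every sequence of integers $0\le k=k(n)\le n$, the distance of the reduced state $\xi^k=\operatorname{tr}_{n-k}|\Psi_n\rangle\langle\Psi_n|$ to $\mathcal P^k(\mathbb C^2)$ is bounded below (a) by $\displaystyle \frac{1}{\sqrt{2\pi e}}\cdot\frac kn+o\!\left(\frac kn\right)$ if $n\to\infty$, $k\to\infty$ and $k=o(n)$; (b) by $\phi(\alpha)+o(1)$ if $n\to\infty$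 and $k/n\to\alpha\in(0,\tfrac12)$, where $$\phi(\alpha)=\frac{1}{2\sqrt{2\pi}}\int_{-\infty}^{\infty}\left|1-(1-\alpha)^{1/2}e^{\alpha u^2/2}\right|e^{-u^2/2}\,du .$$ -/

import Mathlib

open scoped ComplexOrder MatrixOrder

noncomputable section

namespace FiniteDeFinetti

/-- The Hilbert space `(ℂ^d)^{⊗ n}`, written in the orthonormal product basis
`|x₁⟩ ⊗ ⋯ ⊗ |xₙ⟩`, `x : Fin n → Fin d`. -/
abbrev TensorSpace (d n : ℕ) : Type := EuclideanSpace ℂ (Fin n → Fin d)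

/-- Operators on `(ℂ^d)^{⊗ n}`, as matrices in the product basis. -/
abbrev Op (d n : ℕ) : Type := Matrix (Fin n → Fin d) (Fin n → Fin d) ℂ

/-- The symmetric subspace of `(ℂ^d)^{⊗ n}`: the vectors fixed by every permutation of the `n`
tensor factors. In the product basis `π ψ` has the coordinates `x ↦ ψ (x ∘ π)`. -/
def Sym (d n : ℕ) : Submodule ℂ (TensorSpace d n) where
  carrier := {ψ | ∀ (π : Equiv.Perm (Fin n)) (x : Fin n → Fin d), ψ (x ∘ π) = ψ x}
  add_mem' := by
    intro a b ha hb π x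
    simp [ha π x, hb π x]
  zero_mem' := by
    intro π x
    simp
  smul_mem' := by
    intro c a ha π x
    simp [ha π x]

/-- The rank-one operator `|ψ⟩⟨ψ|`. -/
def proj {d n : ℕ} (ψ : TensorSpace d n) : Op d n :=
  Matrix.of fun x y => ψ x * star (ψ y)

/-- The index of the basis vector `|x⟩ ⊗ |z⟩` of `(ℂ^d)^{⊗ n} = (ℂ^d)^{⊗ k} ⊗ (ℂ^d)^{⊗ (n - k)}`. -/
def joinIndex {d n k : ℕ} (h : k ≤ n) (x : Fin k → Fin d) (z : Fin (n - k) → Fin d) :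
    Fin n → Fin d :=
  Fin.append x z ∘ Fin.cast (Nat.add_sub_of_le h).symm

/-- The partial trace `tr_{n-k}` over the last `n - k` tensor factors. -/
def partialTrace {d n k : ℕ} (h : k ≤ n) (ρ : Op d n) : Op d k :=
  Matrix.of fun x y => ∑ z : Fin (n - k) → Fin d, ρ (joinIndex h x z) (joinIndex h y z)

/-- The (mixed) states on `ℂ^d`: density matrices. -/
def DensityMatrix (d : ℕ) : Type :=
  {σ : Fin d → Fin d → ℂ // (Matrix.of σ).PosSemidef ∧ (Matrix.of σ).trace = 1}

/-- The Borel σ-algebra on the states, inherited from the matrix entries. -/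
instance (d : ℕ) : MeasurableSpace (DensityMatrix d) :=
  inferInstanceAs (MeasurableSpace
    {σ : Fin d → Fin d → ℂ // (Matrix.of σ).PosSemidef ∧ (Matrix.of σ).trace = 1})

/-- The operator `σ^{⊗ k}` in the product basis. -/
def tensorPower {d : ℕ} (σ : DensityMatrix d) (k : ℕ) : Op d k :=
  Matrix.of fun x y => ∏ i, σ.1 (x i) (y i)

/-- The set `𝒫^k(ℂ^d)` of the states `∫ σ^{⊗ k} dm(σ)`, with `m` a probability measure on the
states on `ℂ^d`; the operator-valued integral is taken entry by entry (the entries of `σ^{⊗ k}`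
are bounded and continuous in `σ`). -/
def productMixtures (d k : ℕ) : Set (Op d k) :=
  {τ | ∃ m : MeasureTheory.Measure (DensityMatrix d), MeasureTheory.IsProbabilityMeasure m ∧
    ∀ x y, τ x y = ∫ σ, tensorPower σ k x y ∂m}

/-- The trace distance `½ tr |A - B|`, where `|C|` is the square root of `Cᴴ * C`. -/
def traceDist {d n : ℕ} (A B : Op d n) : ℝ :=
  (1 / 2) * (CFC.abs (A - B)).trace.re

/-- The trace distance from an operator to a set of operators. -/
def distTo {d n : ℕ} (A : Op d n) (S : Set (Op d n)) : ℝ :=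
  ⨅ τ : S, traceDist A τ.1

/-- `φ(α) = (1 / (2 √(2π))) ∫ |1 - (1 - α)^{1/2} e^{α u² / 2}| e^{-u² / 2} du`. -/
def phi (α : ℝ) : ℝ :=
  1 / (2 * √(2 * Real.pi)) *
    ∫ u : ℝ, |1 - √(1 - α) * Real.exp (α * u ^ 2 / 2)| * Real.exp (-u ^ 2 / 2)

end FiniteDeFinetti

end

noncomputable section

namespace FiniteDeFinetti

/-! Take a uniformly random balanced binary string of length `2 * halfLen n`, that is n or n + 1,
and let the amplitudes of Ψ_n be the square roots of the probabilities of its first n letters.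
Measuring k factors in the product basis yields k letters drawn without replacement, whereas a state
in 𝒫^k yields a mixture of i.i.d. laws. Measurement does not increase trace distance, so one event
separating the two suffices. Drawing without replacement concentrates the number of ones near k/2,
so the event is a window symmetric about k/2; by `binomialProb_window_le_half` no i.i.d. law, hence
no mixture, gives it more probability than fair coins do. The distance is thus at least the
fair-coin mean, over the window, of the likelihood ratio minus 1 (`distTo_balancedState_ge`).

With u = (2j - k)/√k and α = k/n, `likelihoodRatio_ge` bounds the ratio below by approximately (1 -
α)^{-1/2} exp(-α u²/(2(1 - α))), and by de Moivre–Laplace (`tendsto_coinMean`) u becomes standard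
Gaussian. Cutting the window where this function drops below 1 leaves the Gaussian mean of its
positive excess over 1, which is φ(α) (`phi_eq_integral`). For k = o(n) the excess is (k/n)(1 -
u²)/2 to first order, and the positive part of (1 - u²)/2 has mean 1/√(2πe)
(`integral_posPart_one_sub_sq`). -/

/-- The number of ones in a binary string. -/
def ones {n : ℕ} (x : Fin n → Fin 2) : ℕ := ∑ i, (x i : ℕ)

/-! ### Counting binary strings by their number of ones -/

lemma sum_fin_succ_fun {M : Type*} [AddCommMonoid M] {n : ℕ} (f : (Fin (n + 1) → Fin 2) → M) :
    ∑ x, f x = ∑ x : Fin n → Fin 2, (f (Fin.cons 0 x) + f (Fin.cons 1 x)) := by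
  rw [← (Fin.consEquiv fun _ : Fin (n + 1) => Fin 2).sum_comp, Fintype.sum_prod_type,
    Fin.sum_univ_two, Finset.sum_add_distrib]
  rfl

lemma ones_cons {n : ℕ} (b : Fin 2) (x : Fin n → Fin 2) :
    ones (Fin.cons b x : Fin (n + 1) → Fin 2) = b + ones x := by
  simp [ones, Fin.sum_univ_succ]

lemma ones_comp_perm {n : ℕ} (x : Fin n → Fin 2) (π : Equiv.Perm (Fin n)) :
    ones (x ∘ π) = ones x :=
  Equiv.sum_comp π fun i => (x i : ℕ)

lemma ones_joinIndex {n k : ℕ} (h : k ≤ n) (x : Fin k → Fin 2) (z : Fin (n - k) → Fin 2) :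
    ones (joinIndex h x z) = ones x + ones z := by
  have h1 : ones (joinIndex h x z) = ones (Fin.append x z) :=
    Equiv.sum_comp (finCongr (Nat.add_sub_of_le h).symm) fun i => ((Fin.append x z) i : ℕ)
  rw [h1]
  simp [ones, Fin.sum_univ_add]

/-- The sum of a function of the number of ones against a product weight is a binomial sum. -/
lemma sum_prod_mul_ones {R : Type*} [CommRing R] (w : Fin 2 → R) :
    ∀ (k : ℕ) (f : ℕ → R), ∑ x : Fin k → Fin 2, (∏ i, w (x i)) * f (ones x) =
      ∑ j ∈ Finset.range (k + 1), (k.choose j : R) * (w 1 ^ j * w 0 ^ (k - j)) * f j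
  | 0, f => by simp [ones]
  | k + 1, f => by
    have ih := sum_prod_mul_ones w k
    rw [sum_fin_succ_fun]
    simp only [ones_cons, Fin.prod_univ_succ, Fin.cons_zero, Fin.cons_succ, Fin.val_zero,
      Fin.val_one, zero_add, mul_assoc]
    rw [Finset.sum_add_distrib, ← Finset.mul_sum, ← Finset.mul_sum, ih f,
      ih fun j => f (1 + j), Finset.sum_range_succ' _ (k + 1), Finset.sum_range_succ' _ k]
    have e1 : ∀ j ∈ Finset.range (k + 1),
        ((k + 1).choose (j + 1) : R) * (w 1 ^ (j + 1) * (w 0 ^ (k + 1 - (j + 1)) * f (j + 1))) =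
          w 1 * ((k.choose j : R) * (w 1 ^ j * w 0 ^ (k - j)) * f (1 + j)) +
          (k.choose (j + 1) : R) * (w 1 ^ (j + 1) * (w 0 ^ (k - j) * f (j + 1))) := by
      intro j _
      rw [Nat.choose_succ_succ, Nat.add_sub_add_right, add_comm 1 j]
      push_cast
      ring
    rw [Finset.sum_congr rfl e1, Finset.sum_add_distrib, ← Finset.mul_sum,
      Finset.sum_range_succ (fun j => (k.choose (j + 1) : R) * _) k, Nat.choose_succ_self]
    -- The term j = k vanished with its binomial coefficient, so the subtraction k - (j + 1) is not
    -- truncated.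
    have e2 : ∀ j ∈ Finset.range k,
        (k.choose (j + 1) : R) * (w 1 ^ (j + 1) * (w 0 ^ (k - j) * f (j + 1))) =
          w 0 * ((k.choose (j + 1) : R) * (w 1 ^ (j + 1) * w 0 ^ (k - (j + 1))) * f (j + 1)) := by
      intro j hj
      rw [show k - j = (k - (j + 1)) + 1 by have := Finset.mem_range.1 hj; omega]
      ring
    rw [Finset.sum_congr rfl e2, ← Finset.mul_sum]
    simp
    ring

/-- The number of binary strings of length `r` that complete a string with `w` ones to one with
`m` ones. -/
def completions (r m w : ℕ) : ℕ := if w ≤ m then r.choose (m - w) else 0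

/-- Pascal's rule, by conditioning on the next letter. -/
lemma completions_succ (r m w : ℕ) :
    completions (r + 1) m w = completions r m w + completions r m (w + 1) := by
  unfold completions
  rcases lt_trichotomy w m with h | rfl | h
  · obtain ⟨d, rfl⟩ := Nat.exists_eq_add_of_lt h
    rw [if_pos (by omega), if_pos (by omega), if_pos (by omega),
      show w + d + 1 - w = d + 1 by omega, show w + d + 1 - (w + 1) = d by omega,
      Nat.choose_succ_succ, add_comm]
  · simp
  · rw [if_neg (by omega), if_neg (by omega), if_neg (by omega)]

lemma sum_completions (m r : ℕ) : ∀ s w : ℕ,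
    ∑ z : Fin s → Fin 2, completions r m (w + ones z) = completions (r + s) m w
  | 0, w => by simp [ones]
  | s + 1, w => by
    rw [sum_fin_succ_fun]
    simp only [ones_cons, Fin.val_zero, Fin.val_one, zero_add, ← add_assoc w 1]
    rw [Finset.sum_add_distrib, sum_completions m r s, sum_completions m r s, ← add_assoc,
      completions_succ]

/-! ### The balanced state and its reduced states -/

/-- Half the length of the balanced string from which the amplitudes are built. -/
def halfLen (n : ℕ) : ℕ := (n + 1) / 2

lemma le_two_mul_halfLen (n : ℕ) : n ≤ 2 * halfLen n := by unfold halfLen; omega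

lemma two_mul_halfLen_le (n : ℕ) : 2 * halfLen n ≤ n + 1 := by unfold halfLen; omega

/-- The probability that a uniformly random balanced string of length `2 * halfLen n` starts with
a given string of length `k` with `w` ones. -/
def prefixProb (n k w : ℕ) : ℝ :=
  completions (2 * halfLen n - k) (halfLen n) w / (2 * halfLen n).choose (halfLen n)

lemma prefixProb_nonneg (n k w : ℕ) : 0 ≤ prefixProb n k w := by
  unfold prefixProb; positivity

/-- Consistency of the prefix laws; this is what makes the diagonal of the partial trace explicit.
-/
lemma sum_prefixProb {n k : ℕ} (h : k ≤ n) (w : ℕ) :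
    ∑ z : Fin (n - k) → Fin 2, prefixProb n n (w + ones z) = prefixProb n k w := by
  unfold prefixProb
  rw [← Finset.sum_div, ← Nat.cast_sum, sum_completions]
  congr 4
  have := le_two_mul_halfLen n
  omega

lemma sum_prefixProb_ones {n k : ℕ} (h : k ≤ n) :
    ∑ x : Fin k → Fin 2, prefixProb n k (ones x) = 1 := by
  unfold prefixProb
  have h1 := sum_completions (halfLen n) (2 * halfLen n - k) k 0
  simp only [zero_add] at h1
  rw [← Finset.sum_div, ← Nat.cast_sum, h1, Nat.sub_add_cancel (h.trans (le_two_mul_halfLen n))]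
  have : 0 < (2 * halfLen n).choose (halfLen n) := Nat.choose_pos (by omega)
  simp only [completions, zero_le, if_true, Nat.sub_zero]
  exact div_self (by positivity)

/-- The symmetric state whose measurement in the product basis is the first `n` letters of a
uniformly random balanced string. -/
def balancedState (n : ℕ) : TensorSpace 2 n :=
  WithLp.toLp 2 fun x => ((√(prefixProb n n (ones x)) : ℝ) : ℂ)

lemma balancedState_mem_Sym (n : ℕ) : balancedState n ∈ Sym 2 n := by
  intro π x
  simp [balancedState, ones_comp_perm]

lemma norm_balancedState (n : ℕ) : ‖balancedState n‖ = 1 := by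
  rw [EuclideanSpace.norm_eq, Real.sqrt_eq_one]
  rw [← sum_prefixProb_ones (le_refl n)]
  refine Finset.sum_congr rfl fun x _ => ?_
  simp [balancedState, Real.sq_sqrt (prefixProb_nonneg _ _ _)]

lemma partialTrace_balancedState_diag {n k : ℕ} (h : k ≤ n) (x : Fin k → Fin 2) :
    partialTrace h (proj (balancedState n)) x x = (prefixProb n k (ones x) : ℂ) := by
  rw [← sum_prefixProb h]
  simp only [partialTrace, proj, Matrix.of_apply, balancedState, ones_joinIndex]
  push_cast
  refine Finset.sum_congr rfl fun z _ => ?_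
  rw [Complex.star_def, Complex.conj_ofReal, ← Complex.ofReal_mul,
    Real.mul_self_sqrt (prefixProb_nonneg _ _ _)]

lemma isHermitian_partialTrace_proj {d n k : ℕ} (h : k ≤ n) (ψ : TensorSpace d n) :
    (partialTrace h (proj ψ)).IsHermitian := by
  ext x y
  simp [partialTrace, proj, Matrix.conjTranspose_apply, mul_comm]

/-! ### Measuring in the product basis -/

/-- The diagonal is dominated by the diagonal of the absolute value. -/
lemma abs_re_diag_le_abs {ι : Type*} [Fintype ι] [DecidableEq ι] {C : Matrix ι ι ℂ}
    (hC : C.IsHermitian) (x : ι) : |(C x x).re| ≤ ((CFC.abs C) x x).re := by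
  have hsa : IsSelfAdjoint C := hC
  -- |C| - C and |C| + C are twice the negative and positive parts of C, so their diagonals are
  -- nonnegative.
  have h1 : (0 : Matrix ι ι ℂ) ≤ CFC.abs C - C := by
    rw [CFC.abs_sub_self C hsa, two_nsmul]
    exact add_nonneg (CFC.negPart_nonneg C) (CFC.negPart_nonneg C)
  have h2 : (0 : Matrix ι ι ℂ) ≤ CFC.abs C + C := by
    rw [CFC.abs_add_self C hsa, two_nsmul]
    exact add_nonneg (CFC.posPart_nonneg C) (CFC.posPart_nonneg C)
  have d1 := (Complex.le_def.1 ((Matrix.nonneg_iff_posSemidef.1 h1).diag_nonneg (i := x))).1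
  have d2 := (Complex.le_def.1 ((Matrix.nonneg_iff_posSemidef.1 h2).diag_nonneg (i := x))).1
  simp only [Matrix.sub_apply, Matrix.add_apply, Complex.sub_re, Complex.add_re,
    Complex.zero_re] at d1 d2
  exact abs_le.2 ⟨by linarith, by linarith⟩

lemma half_sum_abs_diag_le_traceDist {d n : ℕ} {A B : Op d n} (hA : A.IsHermitian)
    (hB : B.IsHermitian) : 1 / 2 * ∑ x, |(A x x).re - (B x x).re| ≤ traceDist A B := by
  unfold traceDist
  refine mul_le_mul_of_nonneg_left ?_ (by norm_num)
  rw [Matrix.trace, Complex.re_sum]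
  refine Finset.sum_le_sum fun x _ => ?_
  simpa using abs_re_diag_le_abs (hA.sub hB) x

/-- The probability of a measurement outcome in the computational basis. -/
def outcomeProb {d : ℕ} (σ : DensityMatrix d) (b : Fin d) : ℝ := (σ.1 b b).re

lemma outcomeProb_nonneg {d : ℕ} (σ : DensityMatrix d) (b : Fin d) : 0 ≤ outcomeProb σ b :=
  (Complex.le_def.1 (σ.2.1.diag_nonneg (i := b))).1

lemma diag_eq_outcomeProb {d : ℕ} (σ : DensityMatrix d) (b : Fin d) :
    σ.1 b b = (outcomeProb σ b : ℂ) := by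
  have := (Complex.le_def.1 (σ.2.1.diag_nonneg (i := b))).2
  apply Complex.ext
  · simp [outcomeProb]
  · simpa using this.symm

lemma sum_outcomeProb {d : ℕ} (σ : DensityMatrix d) : ∑ b, outcomeProb σ b = 1 := by
  have := congrArg Complex.re σ.2.2
  simpa [Matrix.trace, outcomeProb] using this

lemma outcomeProb_le_one {d : ℕ} (σ : DensityMatrix d) (b : Fin d) : outcomeProb σ b ≤ 1 := by
  rw [← sum_outcomeProb σ]
  exact Finset.single_le_sum (fun b _ => outcomeProb_nonneg σ b) (Finset.mem_univ b)

lemma measurable_outcomeProb {d : ℕ} (b : Fin d) :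
    Measurable fun σ : DensityMatrix d => outcomeProb σ b := by
  have h : Measurable fun σ : DensityMatrix d => σ.1 := measurable_subtype_coe
  exact Complex.measurable_re.comp ((measurable_pi_apply b).comp ((measurable_pi_apply b).comp h))

lemma tensorPower_diag {d k : ℕ} (σ : DensityMatrix d) (x : Fin k → Fin d) :
    tensorPower σ k x x = ((∏ i, outcomeProb σ (x i) : ℝ) : ℂ) := by
  simp [tensorPower, diag_eq_outcomeProb]

lemma integrable_prod_outcomeProb {d k : ℕ} (m : MeasureTheory.Measure (DensityMatrix d))
    [MeasureTheory.IsProbabilityMeasure m] (x : Fin k → Fin d) :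
    MeasureTheory.Integrable (fun σ => ∏ i, outcomeProb σ (x i)) m := by
  refine MeasureTheory.Integrable.of_bound (C := 1)
    (Finset.measurable_prod _ fun i _ => measurable_outcomeProb (x i)).aestronglyMeasurable ?_
  refine Filter.Eventually.of_forall fun σ => ?_
  rw [Real.norm_eq_abs, abs_of_nonneg (Finset.prod_nonneg fun i _ => outcomeProb_nonneg σ (x i))]
  exact Finset.prod_le_one (fun i _ => outcomeProb_nonneg σ _) fun i _ => outcomeProb_le_one σ _

lemma isHermitian_of_mem_productMixtures {d k : ℕ} {τ : Op d k} (h : τ ∈ productMixtures d k) :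
    τ.IsHermitian := by
  obtain ⟨m, _, hτ⟩ := h
  ext x y
  rw [Matrix.conjTranspose_apply, hτ, hτ, Complex.star_def, ← integral_conj]
  congr 1
  funext σ
  simp only [tensorPower, Matrix.of_apply, map_prod]
  refine Finset.prod_congr rfl fun i _ => ?_
  exact congrFun (congrFun σ.2.1.1 (x i)) (y i)

/-- Over an empty set the real infimum in `distTo` would be 0 by default. The witness is the point
mass at |0⟩⟨0|. -/
lemma productMixtures_nonempty {d : ℕ} [NeZero d] (k : ℕ) : (productMixtures d k).Nonempty := by
  let σ : DensityMatrix d := ⟨Matrix.diagonal (Pi.single 0 1), by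
    refine ⟨Matrix.PosSemidef.diagonal (fun i => ?_), ?_⟩
    · by_cases h : i = 0
      · subst h; simp
      · simp [h]
    · exact (Matrix.trace_diagonal _).trans (by simp)⟩
  exact ⟨fun x y => ∫ σ', tensorPower σ' k x y ∂(MeasureTheory.Measure.dirac σ),
    MeasureTheory.Measure.dirac σ, inferInstance, fun _ _ => rfl⟩

/-- The binomial probability of a set of outcomes. -/
def binomialProb (k : ℕ) (s : Finset ℕ) (p : ℝ) : ℝ :=
  ∑ j ∈ s, (k.choose j : ℝ) * (p ^ j * (1 - p) ^ (k - j))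

lemma sum_range_mul_indicator {k : ℕ} {s : Finset ℕ} (hs : s ⊆ Finset.range (k + 1)) (f : ℕ → ℝ) :
    ∑ j ∈ Finset.range (k + 1), f j * (if j ∈ s then 1 else 0) = ∑ j ∈ s, f j := by
  simp only [mul_ite, mul_one, mul_zero]
  rw [← Finset.sum_filter, Finset.filter_mem_eq_inter, Finset.inter_eq_right.2 hs]

/-- For fixed σ the diagonal of σ^{⊗k} is the law of k independent trials with success probability
σ₁₁, so the event has binomial probability at most b; averaging over m keeps the bound. -/
lemma sum_diag_productMixture_le {k : ℕ} {τ : Op 2 k} (hτ : τ ∈ productMixtures 2 k)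
    {s : Finset ℕ} (hs : s ⊆ Finset.range (k + 1)) {b : ℝ}
    (hb : ∀ p ∈ Set.Icc (0 : ℝ) 1, binomialProb k s p ≤ b) :
    ∑ x, (τ x x).re * (if ones x ∈ s then 1 else 0) ≤ b ∧ ∑ x, (τ x x).re = 1 := by
  obtain ⟨m, hm, hτ⟩ := hτ
  have key : ∀ x, (τ x x).re = ∫ σ, ∏ i, outcomeProb σ (x i) ∂m := fun x => by
    rw [hτ x x]
    simp only [tensorPower_diag]
    rw [integral_complex_ofReal, Complex.ofReal_re]
  have hsum : ∀ σ : DensityMatrix 2, outcomeProb σ 0 = 1 - outcomeProb σ 1 := fun σ => by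
    have := sum_outcomeProb σ
    rw [Fin.sum_univ_two] at this
    linarith
  constructor
  · simp only [key, ← MeasureTheory.integral_mul_const]
    rw [← MeasureTheory.integral_finsetSum _
      fun x _ => (integrable_prod_outcomeProb m x).mul_const _]
    have hp : ∀ σ : DensityMatrix 2, ∑ x : Fin k → Fin 2, (∏ i, outcomeProb σ (x i)) *
        (if ones x ∈ s then (1 : ℝ) else 0) ≤ b := fun σ => by
      rw [sum_prod_mul_ones (outcomeProb σ) k fun j => if j ∈ s then (1 : ℝ) else 0,
        sum_range_mul_indicator hs, hsum]
      exact hb _ ⟨outcomeProb_nonneg σ 1, outcomeProb_le_one σ 1⟩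
    calc _ ≤ ∫ _, b ∂m := by
          refine MeasureTheory.integral_mono ?_ (MeasureTheory.integrable_const b) hp
          exact MeasureTheory.integrable_finsetSum _
            fun x _ => (integrable_prod_outcomeProb m x).mul_const _
      _ = b := by simp
  · simp only [key]
    rw [← MeasureTheory.integral_finsetSum _ fun x _ => integrable_prod_outcomeProb m x]
    have hp : ∀ σ : DensityMatrix 2, ∑ x : Fin k → Fin 2, ∏ i, outcomeProb σ (x i) = 1 :=
      fun σ => by
        rw [← Fintype.piFinset_univ,
          ← Finset.prod_univ_sum (fun _ => Finset.univ) fun _ b => outcomeProb σ b]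
        simp [sum_outcomeProb]
    simp [hp]

lemma half_sum_abs_sub_ge {ι : Type*} [Fintype ι] (f g : ι → ℝ) (p : ι → Prop) [DecidablePred p]
    (h : ∑ x, f x = ∑ x, g x) :
    ∑ x, f x * (if p x then 1 else 0) - ∑ x, g x * (if p x then 1 else 0) ≤
      1 / 2 * ∑ x, |f x - g x| := by
  -- The weight 2·1_p - 1 is ±1, and its constant part contributes nothing because f and g have
  -- equal mass.
  have h1 : ∑ x, (2 * ((f x - g x) * (if p x then 1 else 0)) - (f x - g x)) ≤
      ∑ x, |f x - g x| := by
    refine Finset.sum_le_sum fun x _ => ?_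
    split_ifs
    · linarith [le_abs_self (f x - g x)]
    · linarith [neg_abs_le (f x - g x)]
  rw [Finset.sum_sub_distrib, ← Finset.mul_sum, Finset.sum_sub_distrib, h] at h1
  simp only [sub_mul, Finset.sum_sub_distrib] at h1
  linarith

lemma distTo_balancedState_ge {n k : ℕ} (h : k ≤ n) {s : Finset ℕ}
    (hs : s ⊆ Finset.range (k + 1))
    (hb : ∀ p ∈ Set.Icc (0 : ℝ) 1, binomialProb k s p ≤ binomialProb k s (1 / 2)) :
    ∑ j ∈ s, (k.choose j : ℝ) / 2 ^ k * (2 ^ k * prefixProb n k j - 1) ≤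
      distTo (partialTrace h (proj (balancedState n))) (productMixtures 2 k) := by
  have : Nonempty (productMixtures 2 k) := (productMixtures_nonempty k).to_subtype
  refine le_ciInf fun ⟨τ, hτ⟩ => ?_
  refine le_trans ?_ (half_sum_abs_diag_le_traceDist (isHermitian_partialTrace_proj h _)
    (isHermitian_of_mem_productMixtures hτ))
  obtain ⟨h1, h2⟩ := sum_diag_productMixture_le hτ hs hb
  simp only [partialTrace_balancedState_diag, Complex.ofReal_re]
  refine le_trans ?_ (half_sum_abs_sub_ge _ _ (fun x => ones x ∈ s)
    ((sum_prefixProb_ones h).trans h2.symm))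
  refine le_trans ?_ (sub_le_sub_left h1 _)
  have h3 := sum_prod_mul_ones (fun _ => (1 : ℝ)) k
    fun j => prefixProb n k j * if j ∈ s then 1 else 0
  simp only [Finset.prod_const_one, one_mul, one_pow, mul_one, ← mul_assoc] at h3
  rw [h3, sum_range_mul_indicator hs, binomialProb, ← Finset.sum_sub_distrib]
  refine Finset.sum_le_sum fun j hj => le_of_eq ?_
  have hj' : j ≤ k := Nat.lt_succ_iff.1 (Finset.mem_range.1 (hs hj))
  have e : ((1 : ℝ) / 2) ^ j * (1 - 1 / 2) ^ (k - j) = 1 / 2 ^ k := by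
    rw [show (1 : ℝ) - 1 / 2 = 1 / 2 by norm_num, ← pow_add, Nat.add_sub_cancel' hj']
    simp
  rw [e]
  field_simp

/-! ### Symmetric windows under binomial laws -/

lemma binomialProb_eq_eval (k : ℕ) (s : Finset ℕ) (p : ℝ) :
    binomialProb k s p = (∑ j ∈ s, bernsteinPolynomial ℝ k j).eval p := by
  simp [binomialProb, bernsteinPolynomial, Polynomial.eval_finsetSum, mul_assoc]

/-- Each Bernstein derivative is k times a difference of consecutive Bernstein polynomials of degree
k - 1, so the sum telescopes to its two ends. -/
lemma derivative_sum_Ico_bernsteinPolynomial (k a b : ℕ) (h : a ≤ b) :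
    Polynomial.derivative (∑ j ∈ Finset.Ico (a + 1) (b + 1), bernsteinPolynomial ℝ k j) =
      k * (bernsteinPolynomial ℝ (k - 1) a - bernsteinPolynomial ℝ (k - 1) b) := by
  induction b, h using Nat.le_induction with
  | base => simp
  | succ b hb ih =>
    rw [Finset.sum_Ico_succ_top (by omega), Polynomial.derivative_add, ih,
      bernsteinPolynomial.derivative_succ]
    ring

/-- Among all binomial distributions, the fair one gives the largest probability to a window
symmetric about the centre. -/
lemma binomialProb_window_le_half (k a : ℕ) {p : ℝ} (hp : p ∈ Set.Icc (0 : ℝ) 1) :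
    binomialProb k (Finset.Icc a (k - a)) p ≤ binomialProb k (Finset.Icc a (k - a)) (1 / 2) := by
  rcases a.eq_zero_or_pos with rfl | ha
  · have h1 : ∀ q : ℝ, binomialProb k (Finset.Icc 0 (k - 0)) q = 1 := fun q => by
      have e : Finset.Icc 0 (k - 0) = Finset.range (k + 1) := by ext; simp
      rw [binomialProb_eq_eval, e, bernsteinPolynomial.sum, Polynomial.eval_one]
    rw [h1, h1]
  rcases lt_or_ge (k - a) a with hka | hka
  · rw [Finset.Icc_eq_empty (by omega)]; simp [binomialProb]
  obtain ⟨a, rfl⟩ := Nat.exists_eq_add_of_lt ha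
  simp only [zero_add] at *
  -- The window is now {a + 1, ..., a + 1 + c}, and its two boundary terms in degree k - 1 = a + (a
  -- + 1 + c) share one binomial coefficient. The derivative then has the sign of (1 - q)^(c+1) -
  -- q^(c+1), which changes at q = 1/2.
  obtain ⟨c, rfl⟩ : ∃ c, k = (a + 1) + (a + 1) + c := ⟨k - (a + 1) - (a + 1), by omega⟩
  set F : Polynomial ℝ := ∑ j ∈ Finset.Ico (a + 1) (a + 1 + c + 1),
    bernsteinPolynomial ℝ (a + 1 + (a + 1) + c) j with hF
  have hE : ∀ q, binomialProb (a + 1 + (a + 1) + c)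
      (Finset.Icc (a + 1) (a + 1 + (a + 1) + c - (a + 1))) q = F.eval q := fun q => by
    rw [binomialProb_eq_eval, hF]
    congr 2
    ext; simp; omega
  rw [hE, hE]
  have hD : ∀ q : ℝ, deriv (fun x => F.eval x) q =
      (a + 1 + (a + 1) + c) * ((a + (a + 1 + c)).choose a) * (q ^ a * (1 - q) ^ a) *
        ((1 - q) ^ (c + 1) - q ^ (c + 1)) := fun q => by
    rw [Polynomial.deriv, hF, derivative_sum_Ico_bernsteinPolynomial _ _ _ (by omega)]
    have e1 : a + 1 + (a + 1) + c - 1 = a + (a + 1 + c) := by omega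
    have e2 : (a + (a + 1 + c)).choose (a + 1 + c) = (a + (a + 1 + c)).choose a := by
      rw [Nat.choose_symm_add]
    simp only [e1, bernsteinPolynomial, e2, Polynomial.eval_mul, Polynomial.eval_sub,
      Polynomial.eval_natCast, Polynomial.eval_pow, Polynomial.eval_X, Polynomial.eval_one,
      Nat.add_sub_cancel, Nat.add_sub_cancel_left]
    push_cast
    ring
  have hc : ∀ S, ContinuousOn (fun x => F.eval x) S := fun S => F.continuous.continuousOn
  have hd : ∀ S, DifferentiableOn ℝ (fun x => F.eval x) S := fun S => F.differentiable.differentiableOn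
  rcases le_total p (1 / 2) with h | h
  · refine monotoneOn_of_deriv_nonneg (convex_Icc 0 (1 / 2)) (hc _) (hd _) (fun q hq => ?_)
      ⟨hp.1, h⟩ (Set.right_mem_Icc.2 (by norm_num)) h
    rw [interior_Icc] at hq
    have h1 : (0 : ℝ) ≤ 1 - q := by linarith [hq.2]
    have h0 := hq.1.le
    rw [hD]
    refine mul_nonneg (by positivity) (sub_nonneg.2 ?_)
    exact pow_le_pow_left₀ h0 (by linarith [hq.2]) _
  · refine antitoneOn_of_deriv_nonpos (convex_Icc (1 / 2) 1) (hc _) (hd _) (fun q hq => ?_)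
      (Set.left_mem_Icc.2 (by norm_num)) ⟨h, hp.2⟩ h
    rw [interior_Icc] at hq
    have h1 : (0 : ℝ) ≤ 1 - q := by linarith [hq.2]
    have h0 : (0 : ℝ) ≤ q := by linarith [hq.1]
    rw [hD]
    refine mul_nonpos_of_nonneg_of_nonpos (by positivity) (sub_nonpos.2 ?_)
    exact pow_le_pow_left₀ h1 (by linarith [hq.1]) _

/-! ### Lower bound for the likelihood ratio -/

/-- The probability of the balanced outcome for `2 l` fair coins. -/
def centralProb (l : ℕ) : ℝ := (l.centralBinom : ℝ) / 2 ^ (2 * l)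

lemma centralProb_pos (l : ℕ) : 0 < centralProb l := by
  have := Nat.centralBinom_pos l
  unfold centralProb; positivity

lemma centralProb_succ (l : ℕ) :
    centralProb (l + 1) = centralProb l * ((2 * l + 1) / (2 * l + 2)) := by
  have h : ((l : ℝ) + 1) * (l + 1).centralBinom = 2 * (2 * l + 1) * l.centralBinom := by
    exact_mod_cast Nat.succ_mul_centralBinom_succ l
  have h' : ((l + 1).centralBinom : ℝ) = 2 * (2 * l + 1) * l.centralBinom / (l + 1) := by
    rw [eq_div_iff (by positivity), ← h]; ring
  unfold centralProb
  rw [h', show 2 * (l + 1) = 2 * l + 2 by ring, pow_add]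
  field_simp

/-- Amounts to (2l + 1)(2l + 3) ≤ (2l + 2)². It compares central probabilities at two lengths with
the sharp square-root rate, without Stirling's formula. -/
lemma antitone_centralProb_sq_mul : Antitone fun l : ℕ => centralProb l ^ 2 * (2 * l + 1) := by
  refine antitone_nat_of_succ_le fun l => ?_
  rw [centralProb_succ, mul_pow, mul_assoc]
  refine mul_le_mul_of_nonneg_left ?_ (sq_nonneg _)
  rw [div_pow, div_mul_eq_mul_div, div_le_iff₀ (by positivity)]
  push_cast
  have : (0 : ℝ) ≤ l := l.cast_nonneg
  nlinarith

lemma centralProb_succ_eq (l : ℕ) :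
    ((2 * l + 1).choose l : ℝ) / 2 ^ (2 * l + 1) = centralProb (l + 1) := by
  have h : (l + 1).centralBinom = 2 * (2 * l + 1).choose l := by
    rw [Nat.centralBinom, show 2 * (l + 1) = 2 * l + 1 + 1 by ring, Nat.choose_succ_succ,
      Nat.choose_symm_half]
    ring
  rw [centralProb, h, show 2 * (l + 1) = 2 * l + 1 + 1 by ring, pow_succ (2 : ℝ) (2 * l + 1)]
  push_cast
  field_simp

/-- Induction on the distance i from the centre. With t = M - 2(p + 1), moving from p + 1 to p
multiplies the coefficient by (p + 1)/(p + t + 2) ≥ exp(-(t + 1)/(p + 1)), by 1 + x ≤ exp x. Since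
t² + 4(t + 1) = (t + 2)², the exponents add up to the next square. -/
lemma central_mul_exp_le_choose (M : ℕ) : ∀ i p : ℕ, p + i = M / 2 → 0 < p →
    (M.choose (M / 2) : ℝ) * Real.exp (-((M : ℝ) - 2 * p) ^ 2 / (4 * p)) ≤ M.choose p
  | 0, p, h, hp => by
    rw [add_zero] at h
    rw [← h]
    refine mul_le_of_le_one_right (Nat.cast_nonneg _) (Real.exp_le_one_iff.2 ?_)
    rw [neg_div]
    exact neg_nonpos.2 (by positivity)
  | i + 1, p, h, hp => by
    have ih := central_mul_exp_le_choose M i (p + 1) (by omega) (by omega)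
    obtain ⟨t, ht⟩ : ∃ t, M = 2 * (p + 1) + t := ⟨M - 2 * (p + 1), by omega⟩
    have hM : (M : ℝ) = 2 * (p + 1) + t := by rw [ht]; push_cast; ring
    have hp' : (0 : ℝ) < p := by exact_mod_cast hp
    have ht0 : (0 : ℝ) ≤ t := t.cast_nonneg
    have hrec : (M.choose (p + 1) : ℝ) * (p + 1) = M.choose p * (p + 1 + (t + 1)) := by
      have h1 := Nat.choose_succ_right_eq M p
      rw [show M - p = p + 1 + (t + 1) by omega] at h1
      exact_mod_cast h1
    have hexp : Real.exp (-((M : ℝ) - 2 * p) ^ 2 / (4 * p)) ≤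
        Real.exp (-((M : ℝ) - 2 * (p + 1 : ℕ)) ^ 2 / (4 * (p + 1 : ℕ))) *
          Real.exp (-((t + 1) / (p + 1))) := by
      rw [← Real.exp_add, Real.exp_le_exp, hM]
      push_cast
      have e1 : -(2 * ((p : ℝ) + 1) + t - 2 * (p + 1)) ^ 2 / (4 * (p + 1)) + -((t + 1) / (p + 1)) =
          -((t + 2) ^ 2 / (4 * (p + 1))) := by field_simp; ring
      have e2 : -(2 * ((p : ℝ) + 1) + t - 2 * p) ^ 2 / (4 * p) = -((t + 2) ^ 2 / (4 * p)) := by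
        rw [neg_div]; congr 3; ring
      rw [e1, e2, neg_le_neg_iff]
      gcongr
      linarith
    have hratio : Real.exp (-(((t : ℝ) + 1) / (p + 1))) * (p + 1 + (t + 1)) ≤ p + 1 := by
      rw [Real.exp_neg, inv_mul_le_iff₀ (Real.exp_pos _)]
      have h2 := Real.add_one_le_exp (((t : ℝ) + 1) / (p + 1))
      calc (p : ℝ) + 1 + (t + 1) = ((t + 1) / (p + 1) + 1) * (p + 1) := by field_simp; ring
        _ ≤ _ := by gcongr
    refine (mul_le_mul_of_nonneg_left hexp (Nat.cast_nonneg _)).trans ?_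
    rw [← mul_assoc]
    refine (mul_le_mul_of_nonneg_right ih (Real.exp_pos _).le).trans ?_
    have h3 : (0 : ℝ) < p + 1 + (t + 1) := by linarith
    refine le_of_mul_le_mul_right ?_ h3
    rw [mul_assoc, ← hrec]
    exact mul_le_mul_of_nonneg_left hratio (Nat.cast_nonneg _)

/-- The constant M + 2 serves both parities: M = 2l is compared at l, where 2l + 1 ≤ M + 2, and M =
2l + 1 at l + 1, where 2(l + 1) + 1 = M + 2. -/
lemma centralProb_mul_sqrt_le (m M : ℕ) (hM : M ≤ 2 * m) :
    centralProb m * √((2 * m + 1) / (M + 2)) ≤ (M.choose (M / 2) : ℝ) / 2 ^ M := by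
  have key : ∀ l, l ≤ m → ∀ c : ℝ, (2 * l + 1 : ℝ) ≤ c →
      centralProb m * √((2 * m + 1) / c) ≤ centralProb l := fun l hl c hc => by
    have h := antitone_centralProb_sq_mul hl
    have hl0 : (0 : ℝ) ≤ l := l.cast_nonneg
    have hc0 : 0 < c := by linarith
    refine le_of_sq_le_sq ?_ (centralProb_pos l).le
    rw [mul_pow, Real.sq_sqrt (by positivity), ← mul_div_assoc, div_le_iff₀ hc0]
    exact h.trans (mul_le_mul_of_nonneg_left hc (sq_nonneg _))
  obtain ⟨l, rfl | rfl⟩ := M.even_or_odd'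
  · rw [Nat.mul_div_cancel_left l (by norm_num)]
    exact key l (by omega) _ (by push_cast; linarith)
  · rw [show (2 * l + 1) / 2 = l by omega, centralProb_succ_eq]
    exact key (l + 1) (by omega) _ (by push_cast; linarith)

/-- Lower bound for the likelihood ratio between the hypergeometric and the fair binomial
distribution. -/
lemma likelihoodRatio_ge {n k j : ℕ} (hk : k ≤ n)
    (ht : |2 * (j : ℝ) - k| < 2 * halfLen n - k) :
    √((2 * halfLen n + 1) / (2 * halfLen n - k + 2)) *
      Real.exp (-(2 * (j : ℝ) - k) ^ 2 / (2 * (2 * halfLen n - k - |2 * (j : ℝ) - k|))) ≤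
    2 ^ k * prefixProb n k j := by
  have hkm : k ≤ 2 * halfLen n := hk.trans (le_two_mul_halfLen n)
  unfold prefixProb
  set m := halfLen n
  obtain ⟨M, hM⟩ : ∃ M, 2 * m = k + M := ⟨2 * m - k, by omega⟩
  have hMr : 2 * (m : ℝ) = k + M := by exact_mod_cast hM
  have hMr' : 2 * (m : ℝ) - k = M := by linarith
  rw [hMr'] at ht ⊢
  obtain ⟨h1, h2⟩ := abs_lt.1 ht
  have hj1 : j < m := by
    have : (j : ℝ) < m := by linarith
    exact_mod_cast this
  have hj2 : k < m + j := by
    have : (k : ℝ) < m + j := by linarith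
    exact_mod_cast this
  -- By symmetry of binomial coefficients, p is the smaller of m - j and M - (m - j) = m + j - k,
  -- left of the centre.
  obtain ⟨p, hp0, hpM, hchoose, hpt⟩ : ∃ p : ℕ, 0 < p ∧ p ≤ M / 2 ∧
      M.choose (m - j) = M.choose p ∧ (M : ℝ) - 2 * p = |2 * (j : ℝ) - k| := by
    rcases le_total k (2 * j) with h | h
    · refine ⟨m - j, by omega, by omega, rfl, ?_⟩
      have h' : (k : ℝ) ≤ 2 * j := by exact_mod_cast h
      rw [abs_of_nonneg (by linarith), Nat.cast_sub hj1.le]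
      linarith
    · refine ⟨m + j - k, by omega, by omega, ?_, ?_⟩
      · rw [← Nat.choose_symm (show m - j ≤ M by omega)]
        congr 1
        omega
      · have h' : 2 * (j : ℝ) ≤ k := by exact_mod_cast h
        rw [abs_of_nonpos (by linarith), Nat.cast_sub hj2.le]
        push_cast
        linarith
  have hc := central_mul_exp_le_choose M (M / 2 - p) p (by omega) hp0
  rw [show 2 * m - k = M by omega, completions, if_pos hj1.le, hchoose, ← hpt,
    show (2 * (j : ℝ) - k) ^ 2 = (M - 2 * p) ^ 2 by rw [hpt, sq_abs],
    show 2 * ((M : ℝ) - (M - 2 * p)) = 4 * p by ring]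
  have hs := centralProb_mul_sqrt_le m M (by omega)
  have hcp : centralProb m = ((2 * m).choose m : ℝ) / 2 ^ (2 * m) := rfl
  have hcp0 := centralProb_pos m
  have e : (2 : ℝ) ^ k * ((M.choose p : ℝ) / (2 * m).choose m) =
      (M.choose p : ℝ) / 2 ^ M / centralProb m := by
    rw [hcp, hM, pow_add]
    have : (0 : ℝ) < (k + M).choose m := by
      exact_mod_cast Nat.choose_pos (by omega)
    field_simp
  rw [e, le_div_iff₀ hcp0, mul_comm, ← mul_assoc]
  refine (mul_le_mul_of_nonneg_right hs (Real.exp_pos _).le).trans ?_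
  rw [div_mul_eq_mul_div]
  gcongr

/-! ### The central limit theorem for fair coins -/

open MeasureTheory ProbabilityTheory Filter Topology

/-- The expectation of `f ((2 j - k) / √k)` for `j` the number of heads in `k` fair coin tosses. -/
def coinMean (k : ℕ) (f : ℝ → ℝ) : ℝ :=
  ∑ j ∈ Finset.range (k + 1), (k.choose j : ℝ) / 2 ^ k * f ((2 * j - k) / √k)

/-- The law of the standardized number of heads in `k` fair coin tosses. -/
def coinMeasure (k : ℕ) : Measure ℝ :=
  ∑ j ∈ Finset.range (k + 1),
    ENNReal.ofReal ((k.choose j : ℝ) / 2 ^ k) • Measure.dirac ((2 * j - k) / √k)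

lemma sum_choose_div (k : ℕ) : ∑ j ∈ Finset.range (k + 1), (k.choose j : ℝ) / 2 ^ k = 1 := by
  rw [← Finset.sum_div, ← Nat.cast_sum, Nat.sum_range_choose]
  simp

instance (k : ℕ) : IsProbabilityMeasure (coinMeasure k) := by
  constructor
  simp only [coinMeasure, Measure.finsetSum_apply, Measure.smul_apply, measure_univ, smul_eq_mul,
    mul_one]
  rw [← ENNReal.ofReal_sum_of_nonneg fun j _ => by positivity, sum_choose_div, ENNReal.ofReal_one]

lemma integral_coinMeasure {E : Type*} [NormedAddCommGroup E] [NormedSpace ℝ E] [CompleteSpace E]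
    (k : ℕ) (f : ℝ → E) : ∫ u, f u ∂(coinMeasure k) =
      ∑ j ∈ Finset.range (k + 1), ((k.choose j : ℝ) / 2 ^ k) • f ((2 * j - k) / √k) := by
  unfold coinMeasure
  rw [integral_finsetSum_measure]
  · refine Finset.sum_congr rfl fun j _ => ?_
    rw [integral_smul_measure, integral_dirac, ENNReal.toReal_ofReal (by positivity)]
  · exact fun j _ => (integrable_dirac (by simp)).smul_measure ENNReal.ofReal_ne_top

/-- The law of a fair random sign. -/
def signMeasure : Measure ℝ :=
  ENNReal.ofReal (1 / 2) • Measure.dirac 1 + ENNReal.ofReal (1 / 2) • Measure.dirac (-1)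

instance : IsProbabilityMeasure signMeasure := by
  constructor
  simp only [signMeasure, Measure.add_apply, Measure.smul_apply, measure_univ, smul_eq_mul, mul_one]
  rw [← ENNReal.ofReal_add (by norm_num) (by norm_num)]
  norm_num

lemma integral_signMeasure {E : Type*} [NormedAddCommGroup E] [NormedSpace ℝ E] [CompleteSpace E]
    (f : ℝ → E) : ∫ u, f u ∂signMeasure = (1 / 2 : ℝ) • f 1 + (1 / 2 : ℝ) • f (-1) := by
  unfold signMeasure
  rw [integral_add_measure, integral_smul_measure, integral_smul_measure, integral_dirac,
    integral_dirac, ENNReal.toReal_ofReal (by norm_num)]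
  all_goals exact (integrable_dirac (by simp)).smul_measure ENNReal.ofReal_ne_top

/-- The binomial theorem: the standardized count is a sum of k independent fair signs divided by √k.
-/
lemma charFun_coinMeasure (k : ℕ) (t : ℝ) :
    charFun (coinMeasure k) t = charFun signMeasure ((√k)⁻¹ * t) ^ k := by
  rw [charFun_apply_real, charFun_apply_real, integral_coinMeasure, integral_signMeasure,
    ← smul_add, smul_pow, add_pow, Finset.smul_sum]
  refine Finset.sum_congr rfl fun j hj => ?_
  have hj' : j ≤ k := Nat.lt_succ_iff.1 (Finset.mem_range.1 hj)
  rw [← Complex.exp_nat_mul, ← Complex.exp_nat_mul, ← Complex.exp_add, mul_comm (Complex.exp _),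
    Complex.real_smul, Complex.real_smul, ← mul_assoc]
  congr 1
  · push_cast
    rw [div_pow, one_pow]
    ring
  · congr 1
    rw [Nat.cast_sub hj']
    push_cast
    ring

lemma tendsto_coinMeasure :
    Tendsto (β := ProbabilityMeasure ℝ) (fun k => ⟨coinMeasure k, inferInstance⟩) atTop
      (𝓝 (⟨gaussianReal 0 1, inferInstance⟩ : ProbabilityMeasure ℝ)) := by
  refine ProbabilityMeasure.tendsto_iff_tendsto_charFun.2 fun t => ?_
  have h := tendsto_charFun_inv_sqrt_mul_pow (P := signMeasure) (X := id) aemeasurable_id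
    (by rw [integral_signMeasure]; simp) (by rw [integral_signMeasure]; norm_num) t
  rw [Measure.map_id] at h
  simpa [charFun_coinMeasure, charFun_gaussianReal, neg_div] using h

/-- The de Moivre–Laplace theorem. -/
lemma tendsto_coinMean {f : ℝ → ℝ} (hf : Continuous f) {C : ℝ} (hC : ∀ u, |f u| ≤ C) :
    Tendsto (fun k => coinMean k f) atTop (𝓝 (∫ u, f u ∂(gaussianReal 0 1))) := by
  have h := ProbabilityMeasure.tendsto_iff_forall_integral_tendsto.1 tendsto_coinMeasure
    (BoundedContinuousFunction.ofNormedAddCommGroup f hf C hC)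
  simpa [integral_coinMeasure, coinMean] using h

/-! ### The two Gaussian integrals -/

lemma integral_gaussianReal_zero_one (f : ℝ → ℝ) :
    ∫ u, f u ∂(gaussianReal 0 1) =
      1 / √(2 * Real.pi) * ∫ u, f u * Real.exp (-u ^ 2 / 2) := by
  rw [integral_gaussianReal_eq_integral_smul one_ne_zero, ← integral_const_mul]
  refine integral_congr_ae (Eventually.of_forall fun u => ?_)
  simp [gaussianPDFReal]
  ring

lemma integral_posPart_one_sub_sq :
    ∫ u, max ((1 - u ^ 2) / 2) 0 ∂(gaussianReal 0 1) = 1 / √(2 * Real.pi * Real.exp 1) := by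
  rw [integral_gaussianReal_zero_one]
  have h1 : ∫ u : ℝ, max ((1 - u ^ 2) / 2) 0 * Real.exp (-u ^ 2 / 2) =
      ∫ u in (-1 : ℝ)..1, (1 - u ^ 2) / 2 * Real.exp (-u ^ 2 / 2) := by
    rw [intervalIntegral.integral_of_le (by norm_num), ← integral_Icc_eq_integral_Ioc,
      ← integral_indicator measurableSet_Icc]
    refine integral_congr_ae (Eventually.of_forall fun u => ?_)
    by_cases hu : u ∈ Set.Icc (-1 : ℝ) 1
    · simp only [Set.indicator_of_mem hu]
      rw [max_eq_left (by nlinarith [hu.1, hu.2])]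
    · simp only [Set.indicator_of_notMem hu]
      rw [max_eq_right, zero_mul]
      by_contra hc
      have hc' : u ^ 2 < 1 := by linarith [not_le.1 hc]
      exact hu (abs_le.1 (abs_le_of_sq_le_sq (by linarith) zero_le_one))
  have h2 : ∫ u in (-1 : ℝ)..1, (1 - u ^ 2) / 2 * Real.exp (-u ^ 2 / 2) = Real.exp (-1 / 2) := by
    -- The integrand has the primitive (u/2) exp(-u²/2).
    rw [intervalIntegral.integral_eq_sub_of_hasDerivAt (f := fun u => u / 2 * Real.exp (-u ^ 2 / 2))]
    · norm_num; ring
    · intro u _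
      have h3 : HasDerivAt (fun u : ℝ => -u ^ 2 / 2) (-u) u := by
        refine (((hasDerivAt_id' u).pow 2).neg.div_const 2).congr_deriv ?_
        norm_num
        ring
      refine (((hasDerivAt_id' u).div_const 2).mul h3.exp).congr_deriv ?_
      ring
    · exact Continuous.intervalIntegrable (by fun_prop) _ _
  rw [h1, h2, Real.sqrt_mul (by positivity : 0 ≤ 2 * Real.pi), neg_div, Real.exp_neg, Real.exp_half,
    ← one_div, one_div_mul_one_div]

/-- Substituting v = √(1 - α) u turns the integrand of φ into |F|, where F is √(2π) times the
difference of the centred Gaussian densities of variances 1 - α and 1. Since ∫ F = 0, the integral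
of |F| is twice that of F⁺. -/
lemma phi_eq_integral {α : ℝ} (h1 : α < 1) :
    phi α = ∫ u, max (1 / √(1 - α) * Real.exp (-(α / (1 - α)) * u ^ 2 / 2) - 1) 0
      ∂(gaussianReal 0 1) := by
  have hs2 : 0 < 1 - α := by linarith
  have hs : 0 < √(1 - α) := Real.sqrt_pos.2 hs2
  have hsq : √(1 - α) ^ 2 = 1 - α := Real.sq_sqrt hs2.le
  set s := √(1 - α) with hsdef
  rw [integral_gaussianReal_zero_one, phi, ← hsdef]
  set F : ℝ → ℝ := fun v => s⁻¹ * Real.exp (-(1 / (2 * (1 - α))) * v ^ 2) -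
    Real.exp (-(1 / 2) * v ^ 2) with hF
  have i1 : Integrable fun v : ℝ => s⁻¹ * Real.exp (-(1 / (2 * (1 - α))) * v ^ 2) :=
    (integrable_exp_neg_mul_sq (by positivity)).const_mul _
  have i2 : Integrable fun v : ℝ => Real.exp (-(1 / 2) * v ^ 2) :=
    integrable_exp_neg_mul_sq (by norm_num)
  have hFi : Integrable F := i1.sub i2
  have hF0 : ∫ v, F v = 0 := by
    rw [hF, integral_sub i1 i2, integral_const_mul, integral_gaussian, integral_gaussian,
      show Real.pi / (1 / (2 * (1 - α))) = (1 - α) * (Real.pi / (1 / 2)) by field_simp,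
      Real.sqrt_mul hs2.le, ← hsdef]
    field_simp
    ring
  have habs := integral_abs_eq_two_mul_integral_posPart_sub_integral hFi
  have e1 : ∀ v, (F v)⁺ = max (1 / s * Real.exp (-(α / (1 - α)) * v ^ 2 / 2) - 1) 0 *
      Real.exp (-v ^ 2 / 2) := fun v => by
    rw [posPart_def, max_mul_of_nonneg _ _ (Real.exp_pos _).le, zero_mul, sub_mul, mul_assoc,
      ← Real.exp_add, one_mul, one_div]
    change max (F v) 0 = _
    simp only [hF]
    have a1 : -(1 / (2 * (1 - α))) * v ^ 2 = -(α / (1 - α)) * v ^ 2 / 2 + -v ^ 2 / 2 := by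
      field_simp
      ring
    have a2 : -(1 / 2) * v ^ 2 = -v ^ 2 / 2 := by ring
    rw [a1, a2]
  have e2 : ∫ u : ℝ, |1 - s * Real.exp (α * u ^ 2 / 2)| * Real.exp (-u ^ 2 / 2) =
      ∫ v, |F v| := by
    have h3 := Measure.integral_comp_mul_left
      (fun u : ℝ => |1 - s * Real.exp (α * u ^ 2 / 2)| * Real.exp (-u ^ 2 / 2)) s⁻¹
    rw [inv_inv, abs_of_pos hs, smul_eq_mul, eq_comm, mul_comm, ← eq_div_iff hs.ne',
      div_eq_inv_mul, ← integral_const_mul] at h3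
    rw [h3]
    refine integral_congr_ae (Eventually.of_forall fun v => ?_)
    have e3 : (s⁻¹ * v) ^ 2 = v ^ 2 / (1 - α) := by rw [mul_pow, inv_pow, hsq]; field_simp
    simp only [e3, hF]
    have a1 : s⁻¹ * Real.exp (-(1 / (2 * (1 - α))) * v ^ 2) - Real.exp (-(1 / 2) * v ^ 2) =
        s⁻¹ * ((1 - s * Real.exp (α * (v ^ 2 / (1 - α)) / 2)) *
          Real.exp (-(v ^ 2 / (1 - α)) / 2)) := by
      rw [sub_mul 1, mul_sub s⁻¹, mul_assoc s, ← Real.exp_add, one_mul, inv_mul_cancel_left₀ hs.ne',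
        show -(1 / (2 * (1 - α))) * v ^ 2 = -(v ^ 2 / (1 - α)) / 2 by field_simp,
        show -(1 / 2) * v ^ 2 = α * (v ^ 2 / (1 - α)) / 2 + -(v ^ 2 / (1 - α)) / 2 by
          field_simp; ring]
    rw [a1, abs_mul, abs_mul, abs_of_pos (inv_pos.2 hs), abs_of_pos (Real.exp_pos _)]
  rw [e2, habs, hF0, sub_zero]
  simp only [e1]
  field_simp

/-! ### From fair-coin means to the distance -/

lemma coinMean_mono (k : ℕ) {f g : ℝ → ℝ} (h : ∀ u, f u ≤ g u) : coinMean k f ≤ coinMean k g :=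
  Finset.sum_le_sum fun j _ => mul_le_mul_of_nonneg_left (h _) (by positivity)

lemma coinMean_mul_sub (k : ℕ) (f : ℝ → ℝ) (ε δ : ℝ) :
    coinMean k (fun u => ε * (f u - δ)) = ε * (coinMean k f - δ) := by
  have h : ε * (coinMean k f - δ) = ε * (coinMean k f -
      (∑ j ∈ Finset.range (k + 1), (k.choose j : ℝ) / 2 ^ k) * δ) := by
    rw [sum_choose_div, one_mul]
  rw [h, coinMean, coinMean, Finset.sum_mul, ← Finset.sum_sub_distrib, Finset.mul_sum]
  exact Finset.sum_congr rfl fun j _ => by ring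

/-- The amplitude of the Gaussian lower bound for the likelihood ratio. -/
def ratioAmp (n k : ℕ) : ℝ := √((2 * halfLen n + 1) / (2 * halfLen n - k + 2))

/-- The rate of the Gaussian lower bound for the likelihood ratio on the window `|u| ≤ c`. -/
def ratioRate (n k : ℕ) (c : ℝ) : ℝ := k / (2 * halfLen n - k - c * √k)

lemma coinMean_window_le_distTo {n k : ℕ} (hk : k ≤ n) (hk0 : 0 < k) {c : ℝ} (hc0 : 0 ≤ c)
    (hc : c * √k < 2 * halfLen n - k) :
    coinMean k (fun u => if |u| ≤ c then
        ratioAmp n k * Real.exp (-ratioRate n k c * u ^ 2 / 2) - 1 else 0) ≤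
      distTo (partialTrace hk (proj (balancedState n))) (productMixtures 2 k) := by
  have hkr : (0 : ℝ) < k := by exact_mod_cast hk0
  have hsk : 0 < √(k : ℝ) := Real.sqrt_pos.2 hkr
  -- The condition |u| ≤ c says that both j and k - j are at least (k - c√k)/2. If that number is
  -- negative, the ceiling is 0 and the window is everything.
  set a : ℕ := ⌈((k : ℝ) - c * √k) / 2⌉₊ with ha
  have hs : Finset.Icc a (k - a) ⊆ Finset.range (k + 1) := fun j hj => by
    rw [Finset.mem_Icc] at hj
    exact Finset.mem_range.2 (by omega)
  have hmem : ∀ j ∈ Finset.range (k + 1),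
      (j ∈ Finset.Icc a (k - a) ↔ |(2 * (j : ℝ) - k) / √k| ≤ c) := fun j hj => by
    have hj' : j ≤ k := Nat.lt_succ_iff.1 (Finset.mem_range.1 hj)
    have hak : a ≤ k := Nat.ceil_le.2 (by nlinarith [mul_nonneg hc0 hsk.le])
    rw [Finset.mem_Icc, show j ≤ k - a ↔ a ≤ k - j by omega, ha, Nat.ceil_le, Nat.ceil_le,
      Nat.cast_sub hj', abs_div, abs_of_pos hsk, div_le_iff₀ hsk, abs_le]
    constructor
    · rintro ⟨h1, h2⟩; exact ⟨by linarith, by linarith⟩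
    · rintro ⟨h1, h2⟩; exact ⟨by linarith, by linarith⟩
  refine le_trans ?_ (distTo_balancedState_ge hk hs fun p hp => binomialProb_window_le_half k a hp)
  rw [coinMean, ← sum_range_mul_indicator hs]
  refine Finset.sum_le_sum fun j hj => ?_
  rw [mul_assoc]
  refine mul_le_mul_of_nonneg_left ?_ (by positivity)
  by_cases hw : |(2 * (j : ℝ) - k) / √k| ≤ c
  · rw [if_pos hw, if_pos ((hmem j hj).2 hw), mul_one]
    rw [abs_div, abs_of_pos hsk, div_le_iff₀ hsk] at hw
    refine sub_le_sub_right (le_trans ?_ (likelihoodRatio_ge hk (hw.trans_lt hc))) 1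
    refine mul_le_mul_of_nonneg_left (Real.exp_le_exp.2 ?_) (Real.sqrt_nonneg _)
    have h1 : 0 < 2 * (halfLen n : ℝ) - k - c * √k := by linarith
    have h2 : -ratioRate n k c * ((2 * (j : ℝ) - k) / √k) ^ 2 / 2 =
        -(2 * (j : ℝ) - k) ^ 2 / (2 * (2 * halfLen n - k - c * √k)) := by
      rw [ratioRate, div_pow, Real.sq_sqrt hkr.le]
      field_simp
    -- On the window |2j - k| ≤ c√k, so the rate that depends on j is replaced by its worst value.
    rw [h2, neg_div, neg_div, neg_le_neg_iff]
    gcongr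
  · rw [if_neg hw, if_neg (mt (hmem j hj).1 hw), mul_zero]

/-! ### Asymptotics in the two regimes -/

section Asymptotics

variable {k : ℕ → ℕ} {α : ℝ}

lemma tendsto_inv_nat : Tendsto (fun n : ℕ => (1 : ℝ) / n) atTop (𝓝 0) :=
  tendsto_const_div_atTop_nhds_zero_nat 1

lemma tendsto_two_mul_halfLen_div :
    Tendsto (fun n : ℕ => 2 * (halfLen n : ℝ) / n) atTop (𝓝 1) := by
  have h : Tendsto (fun n : ℕ => 1 + (1 : ℝ) / n) atTop (𝓝 1) := by
    simpa using tendsto_const_nhds.add tendsto_inv_nat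
  refine tendsto_of_tendsto_of_tendsto_of_le_of_le' tendsto_const_nhds h ?_ ?_
  · filter_upwards [eventually_gt_atTop 0] with n hn
    have hn' : (0 : ℝ) < n := by exact_mod_cast hn
    rw [le_div_iff₀ hn', one_mul]
    exact_mod_cast le_two_mul_halfLen n
  · filter_upwards [eventually_gt_atTop 0] with n hn
    have hn' : (0 : ℝ) < n := by exact_mod_cast hn
    rw [div_le_iff₀ hn', add_mul, one_mul, div_mul_cancel₀ _ hn'.ne']
    exact_mod_cast two_mul_halfLen_le n

lemma tendsto_rest_div (hα : Tendsto (fun n => (k n : ℝ) / n) atTop (𝓝 α)) :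
    Tendsto (fun n : ℕ => (2 * (halfLen n : ℝ) - k n + 2) / n) atTop (𝓝 (1 - α)) := by
  have h := (tendsto_two_mul_halfLen_div.sub hα).add (tendsto_inv_nat.const_mul 2)
  rw [mul_zero, add_zero] at h
  refine h.congr fun n => by ring

lemma tendsto_window_div (hk : ∀ n, k n ≤ n)
    (hα : Tendsto (fun n => (k n : ℝ) / n) atTop (𝓝 α)) (c : ℝ) :
    Tendsto (fun n : ℕ => (2 * (halfLen n : ℝ) - k n - c * √(k n)) / n) atTop (𝓝 (1 - α)) := by
  have h0 : Tendsto (fun n : ℕ => √(k n : ℝ) / n) atTop (𝓝 0) := by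
    have h1 : Tendsto (fun n : ℕ => √((1 : ℝ) / n)) atTop (𝓝 0) := by
      simpa using tendsto_inv_nat.sqrt
    refine squeeze_zero (fun n => by positivity) (fun n => ?_) h1
    rcases n.eq_zero_or_pos with rfl | hn
    · simp
    have hn' : (0 : ℝ) < n := by exact_mod_cast hn
    refine Real.le_sqrt_of_sq_le ?_
    rw [div_pow, Real.sq_sqrt (Nat.cast_nonneg _), div_le_div_iff₀ (by positivity) hn', one_mul, sq]
    have : (k n : ℝ) ≤ n := by exact_mod_cast hk n
    gcongr
  have h := (tendsto_two_mul_halfLen_div.sub hα).sub (h0.const_mul c)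
  rw [mul_zero, sub_zero] at h
  refine h.congr fun n => by ring

lemma tendsto_ratioAmp (hα1 : α < 1) (hα : Tendsto (fun n => (k n : ℝ) / n) atTop (𝓝 α)) :
    Tendsto (fun n => ratioAmp n (k n)) atTop (𝓝 (1 / √(1 - α))) := by
  have h1 : Tendsto (fun n : ℕ => (2 * (halfLen n : ℝ) + 1) / n) atTop (𝓝 1) := by
    have h := tendsto_two_mul_halfLen_div.add tendsto_inv_nat
    rw [add_zero] at h
    refine h.congr fun n => by ring
  have h2 := (h1.div (tendsto_rest_div hα) (by linarith)).sqrt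
  rw [Real.sqrt_div zero_le_one, Real.sqrt_one] at h2
  refine h2.congr' ?_
  filter_upwards [eventually_gt_atTop 0] with n hn
  have hn' : (n : ℝ) ≠ 0 := by exact_mod_cast hn.ne'
  rw [ratioAmp]
  congr 1
  exact div_div_div_cancel_right₀ hn' _ _

lemma tendsto_ratioRate_div (hk : ∀ n, k n ≤ n) (hk0 : ∀ᶠ n in atTop, 0 < k n) (hα1 : α < 1)
    (hα : Tendsto (fun n => (k n : ℝ) / n) atTop (𝓝 α)) (c : ℝ) :
    Tendsto (fun n => ratioRate n (k n) c / (k n / n)) atTop (𝓝 (1 / (1 - α))) := by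
  refine ((tendsto_const_nhds (x := (1 : ℝ))).div (tendsto_window_div hk hα c)
    (by linarith)).congr' ?_
  filter_upwards [eventually_gt_atTop 0, hk0] with n hn hkn
  have hn' : (n : ℝ) ≠ 0 := by exact_mod_cast hn.ne'
  have hk' : (k n : ℝ) ≠ 0 := by exact_mod_cast hkn.ne'
  simp only [ratioRate, Pi.div_apply]
  field_simp

lemma eventually_window_lt (hk : ∀ n, k n ≤ n) (hα1 : α < 1)
    (hα : Tendsto (fun n => (k n : ℝ) / n) atTop (𝓝 α)) (c : ℝ) :
    ∀ᶠ n in atTop, c * √(k n) < 2 * (halfLen n : ℝ) - k n := by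
  filter_upwards [eventually_gt_atTop 0,
    (tendsto_window_div hk hα c).eventually_const_lt (by linarith : (0 : ℝ) < 1 - α)] with n hn h
  have hn' : (0 : ℝ) < n := by exact_mod_cast hn
  have := (div_pos_iff_of_pos_right hn').1 h
  linarith

/-- With A the amplitude, A - 1 = (A² - 1)/(A + 1) and A² - 1 = (k - 1)/(2 `halfLen n` - k + 2); k →
∞ makes (k - 1)/k tend to 1. -/
lemma tendsto_ratioAmp_sub_one_div (hktop : Tendsto k atTop atTop)
    (h0 : Tendsto (fun n => (k n : ℝ) / n) atTop (𝓝 0)) :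
    Tendsto (fun n => (ratioAmp n (k n) - 1) / (k n / n)) atTop (𝓝 (1 / 2)) := by
  have hA := tendsto_ratioAmp zero_lt_one h0
  have hM := tendsto_rest_div h0
  simp only [sub_zero, Real.sqrt_one, div_one] at hA hM
  have hkinv : Tendsto (fun n => 1 - (1 : ℝ) / k n) atTop (𝓝 1) := by
    simpa using tendsto_const_nhds.sub (tendsto_inv_nat.comp hktop)
  have h := (hkinv.div hM one_ne_zero).div (hA.add_const 1) (by norm_num)
  norm_num at h
  norm_num
  refine h.congr' ?_
  filter_upwards [eventually_gt_atTop 0, hktop.eventually_gt_atTop 0,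
    hM.eventually_const_lt zero_lt_one] with n hn hkn hMn
  have hn' : (0 : ℝ) < n := by exact_mod_cast hn
  have hk' : (0 : ℝ) < k n := by exact_mod_cast hkn
  have hMp := (div_pos_iff_of_pos_right hn').1 hMn
  have hA0 : 0 ≤ ratioAmp n (k n) := Real.sqrt_nonneg _
  have hsq : ratioAmp n (k n) ^ 2 = (2 * halfLen n + 1) / (2 * halfLen n - k n + 2) :=
    Real.sq_sqrt (by positivity)
  rw [eq_div_iff (by positivity)] at hsq
  simp only [Pi.div_apply]
  rw [div_div, div_eq_div_iff (by positivity) (by positivity)]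
  field_simp
  linear_combination (-1 : ℝ) * hsq

lemma exists_isLittleO_bound_distTo (hk : ∀ n, k n ≤ n) (hktop : Tendsto k atTop atTop)
    (h0 : Tendsto (fun n => (k n : ℝ) / n) atTop (𝓝 0)) :
    ∃ e : ℕ → ℝ, e =o[atTop] (fun n => (k n : ℝ) / n) ∧ ∀ n,
      1 / √(2 * Real.pi * Real.exp 1) * ((k n : ℝ) / n) + e n ≤
        distTo (partialTrace (hk n) (proj (balancedState n))) (productMixtures 2 (k n)) := by
  set C := 1 / √(2 * Real.pi * Real.exp 1) with hC
  set D : ℕ → ℝ := fun n =>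
    distTo (partialTrace (hk n) (proj (balancedState n))) (productMixtures 2 (k n)) with hD
  set g : ℝ → ℝ := fun u => max ((1 - u ^ 2) / 2) 0 with hg
  set x : ℕ → ℝ := fun n => (ratioAmp n (k n) - 1) / (k n / n) with hx
  set y : ℕ → ℝ := fun n => ratioAmp n (k n) * (ratioRate n (k n) 1 / (k n / n)) with hy
  have hk0 := hktop.eventually_gt_atTop 0
  have hxl : Tendsto x atTop (𝓝 (1 / 2)) := tendsto_ratioAmp_sub_one_div hktop h0
  have hyl : Tendsto y atTop (𝓝 1) := by
    simpa using (tendsto_ratioAmp zero_lt_one h0).mul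
      (tendsto_ratioRate_div hk hk0 zero_lt_one h0 1)
  have hgl : Tendsto (fun n => coinMean (k n) g) atTop (𝓝 C) := by
    rw [hC, ← integral_posPart_one_sub_sq]
    refine (tendsto_coinMean (by fun_prop) (C := 1) fun u => ?_).comp hktop
    rw [abs_of_nonneg (le_max_right _ _)]
    exact max_le (by nlinarith [sq_nonneg u]) zero_le_one
  set r : ℕ → ℝ := fun n => coinMean (k n) g - (|x n - 1 / 2| + |y n - 1|) - C with hr
  have hrl : Tendsto r atTop (𝓝 0) := by
    have h := (hgl.sub ((hxl.sub_const (1 / 2)).abs.add (hyl.sub_const 1).abs)).sub_const C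
    rwa [sub_self, sub_self, abs_zero, add_zero, sub_zero, sub_self] at h
  have hlow : ∀ᶠ n in atTop, (k n : ℝ) / n * r n ≤ D n - C * ((k n : ℝ) / n) := by
    filter_upwards [eventually_gt_atTop 0, hk0, eventually_window_lt hk zero_lt_one h0 1]
      with n hn hkn hw
    have hn' : (0 : ℝ) < n := by exact_mod_cast hn
    have hk' : (0 : ℝ) < k n := by exact_mod_cast hkn
    have hε : (0 : ℝ) < k n / n := by positivity
    refine le_sub_iff_add_le.2 (le_trans (le_of_eq ?_)
      (coinMean_window_le_distTo (hk n) hkn zero_le_one hw |>.trans' (coinMean_mono (k n)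
        (f := fun u => (k n : ℝ) / n * (g u - (|x n - 1 / 2| + |y n - 1|))) fun u => ?_)))
    · rw [coinMean_mul_sub]; ring
    have hδ : 0 ≤ |x n - 1 / 2| + |y n - 1| := by positivity
    split_ifs with hu
    · have hu2 : u ^ 2 ≤ 1 := (sq_le_one_iff_abs_le_one u).2 hu
      have hgu : g u = (1 - u ^ 2) / 2 := max_eq_left (by linarith)
      have e1 : ratioAmp n (k n) = 1 + (k n : ℝ) / n * x n := by simp only [hx]; field_simp; ring
      have e2 : ratioAmp n (k n) * ratioRate n (k n) 1 = (k n : ℝ) / n * y n := by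
        simp only [hy]; field_simp
      -- Linearizing the exponential bounds the excess below by (k/n)(x - y u²/2), with x → 1/2 and
      -- y → 1. The window |u| ≤ 1 is where the limit (1 - u²)/2 is nonnegative.
      have h1 := Real.add_one_le_exp (-ratioRate n (k n) 1 * u ^ 2 / 2)
      have h2 := mul_le_mul_of_nonneg_left h1 (show 0 ≤ ratioAmp n (k n) from Real.sqrt_nonneg _)
      have h3 : ratioAmp n (k n) * (-ratioRate n (k n) 1 * u ^ 2 / 2 + 1) - 1 =
          (k n : ℝ) / n * (x n - y n * u ^ 2 / 2) := by
        linear_combination (-u ^ 2 / 2) * e2 + e1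
      refine le_trans ?_ (sub_le_sub_right h2 1)
      rw [h3, hgu]
      refine mul_le_mul_of_nonneg_left ?_ hε.le
      have h4 := neg_abs_le (x n - 1 / 2)
      have h5 : (y n - 1) * u ^ 2 ≤ |y n - 1| :=
        (le_abs_self _).trans (by
          rw [abs_mul, abs_of_nonneg (sq_nonneg u)]
          exact mul_le_of_le_one_right (abs_nonneg _) hu2)
      have h6 := abs_nonneg (y n - 1)
      linarith
    · have hgu : g u = 0 := max_eq_right (by
        have : 1 < u ^ 2 := (one_lt_sq_iff_one_lt_abs u).2 (not_le.1 hu)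
        linarith)
      rw [hgu]
      exact mul_nonpos_of_nonneg_of_nonpos hε.le (by linarith)
  -- Truncating at 0 makes the inequality hold for every n, while the eventual lower bound controls
  -- the size of the error.
  refine ⟨fun n => min (D n - C * ((k n : ℝ) / n)) 0, ?_, fun n => ?_⟩
  · refine Asymptotics.isLittleO_iff.2 fun δ hδ => ?_
    filter_upwards [hlow, hrl.eventually_const_lt (neg_neg_of_pos hδ)] with n h1 h2
    have hε : (0 : ℝ) ≤ k n / n := by positivity
    rw [Real.norm_eq_abs, Real.norm_eq_abs, abs_of_nonpos (min_le_right _ _), abs_of_nonneg hε,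
      neg_le]
    refine le_min ?_ (neg_nonpos.2 (by positivity))
    nlinarith [mul_le_mul_of_nonneg_left h2.le hε]
  · linarith [min_le_left (D n - C * ((k n : ℝ) / n)) 0]

lemma exists_tendsto_bound_distTo (hk : ∀ n, k n ≤ n) (hα0 : 0 < α) (hα1 : α < 1)
    (hα : Tendsto (fun n => (k n : ℝ) / n) atTop (𝓝 α)) :
    ∃ e : ℕ → ℝ, Tendsto e atTop (𝓝 0) ∧ ∀ n, phi α + e n ≤
        distTo (partialTrace (hk n) (proj (balancedState n))) (productMixtures 2 (k n)) := by
  set D : ℕ → ℝ := fun n =>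
    distTo (partialTrace (hk n) (proj (balancedState n))) (productMixtures 2 (k n)) with hD
  set A := 1 / √(1 - α) with hA
  set β := α / (1 - α) with hβ
  have hα' : 0 < 1 - α := by linarith
  have hβ0 : 0 < β := by positivity
  have hs : 0 < √(1 - α) := Real.sqrt_pos.2 hα'
  have hA1 : 1 < A := by
    rw [hA, lt_div_iff₀ hs, one_mul, Real.sqrt_lt' one_pos]
    linarith
  have hA0 : 0 < A := by linarith
  -- The solution of A exp(-β c²/2) = 1: the limiting ratio is at least 1 exactly on |u| ≤ c.
  set c := √(2 * Real.log A / β) with hc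
  have hc0 : 0 ≤ c := Real.sqrt_nonneg _
  have hlog := Real.log_pos hA1
  have hc2 : c ^ 2 = 2 * Real.log A / β := Real.sq_sqrt (by positivity)
  have hktop : Tendsto k atTop atTop := by
    refine (tendsto_natCast_atTop_iff (R := ℝ)).1 ?_
    refine (hα.pos_mul_atTop hα0 tendsto_natCast_atTop_atTop).congr' ?_
    filter_upwards [eventually_gt_atTop 0] with n hn
    exact div_mul_cancel₀ _ (by exact_mod_cast hn.ne')
  have hk0 := hktop.eventually_gt_atTop 0
  set g : ℝ → ℝ := fun u => max (A * Real.exp (-β * u ^ 2 / 2) - 1) 0 with hg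
  have hgl : Tendsto (fun n => coinMean (k n) g) atTop (𝓝 (phi α)) := by
    rw [phi_eq_integral hα1]
    refine (tendsto_coinMean (by fun_prop) (C := A) fun u => ?_).comp hktop
    rw [abs_of_nonneg (le_max_right _ _)]
    refine max_le ?_ hA0.le
    have : Real.exp (-β * u ^ 2 / 2) ≤ 1 := Real.exp_le_one_iff.2 (by
      have : 0 ≤ β * u ^ 2 := by positivity
      linarith)
    nlinarith
  have hAl : Tendsto (fun n => ratioAmp n (k n)) atTop (𝓝 A) := tendsto_ratioAmp hα1 hα
  have hβl : Tendsto (fun n => ratioRate n (k n) c) atTop (𝓝 β) := by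
    have h := (tendsto_ratioRate_div hk hk0 hα1 hα c).mul hα
    rw [one_div_mul_eq_div] at h
    refine h.congr' ?_
    filter_upwards [eventually_gt_atTop 0, hk0] with n hn hkn
    have hn' : (0 : ℝ) < n := by exact_mod_cast hn
    have hk' : (0 : ℝ) < k n := by exact_mod_cast hkn
    exact div_mul_cancel₀ _ (by positivity)
  -- A bound, uniform over |u| ≤ c, for how far the ratio's lower bound can fall below its limit.
  set δ : ℕ → ℝ := fun n =>
    |ratioAmp n (k n) - A| + A * (c ^ 2 * |ratioRate n (k n) c - β|) with hδ
  have hδl : Tendsto δ atTop (𝓝 0) := by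
    simpa using (hAl.sub_const A).abs.add ((((hβl.sub_const β).abs.const_mul (c ^ 2))).const_mul A)
  set r : ℕ → ℝ := fun n => coinMean (k n) g - δ n - phi α with hr
  have hrl : Tendsto r atTop (𝓝 0) := by simpa using (hgl.sub hδl).sub_const (phi α)
  have hlow : ∀ᶠ n in atTop, r n ≤ D n - phi α := by
    filter_upwards [hk0, eventually_window_lt hk hα1 hα c,
      hβl.eventually_const_lt hβ0] with n hkn hw hb
    refine sub_le_sub_right (le_trans (le_of_eq ?_)
      (coinMean_window_le_distTo (hk n) hkn hc0 hw |>.trans' (coinMean_mono (k n)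
        (f := fun u => 1 * (g u - δ n)) fun u => ?_))) _
    · rw [coinMean_mul_sub, one_mul]
    have hδ0 : 0 ≤ δ n := by positivity
    rw [one_mul]
    have hAexp : A * Real.exp (-β * u ^ 2 / 2) = Real.exp (Real.log A - β * u ^ 2 / 2) := by
      rw [sub_eq_add_neg, Real.exp_add, Real.exp_log hA0]
      congr 2; ring
    split_ifs with hu
    · have hu2 : u ^ 2 ≤ c ^ 2 := sq_le_sq.2 (hu.trans (le_abs_self c))
      have hgu : g u = A * Real.exp (-β * u ^ 2 / 2) - 1 := by
        refine max_eq_left (sub_nonneg.2 ?_)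
        rw [hAexp, Real.one_le_exp_iff]
        have := mul_le_mul_of_nonneg_left hu2 hβ0.le
        rw [hc2, mul_div_cancel₀ _ hβ0.ne'] at this
        linarith
      rw [hgu]
      set b := ratioRate n (k n) c
      have h1 : Real.exp (-b * u ^ 2 / 2) ≤ 1 := Real.exp_le_one_iff.2 (by
        have : 0 ≤ b * u ^ 2 := by positivity
        linarith)
      have h2 : Real.exp (-β * u ^ 2 / 2) - Real.exp (-b * u ^ 2 / 2) ≤ c ^ 2 * |b - β| := by
        have h3 := Real.add_one_le_exp (-b * u ^ 2 / 2 - -β * u ^ 2 / 2)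
        have h4 : Real.exp (-b * u ^ 2 / 2) = Real.exp (-β * u ^ 2 / 2) *
            Real.exp (-b * u ^ 2 / 2 - -β * u ^ 2 / 2) := by
          rw [← Real.exp_add]; congr 1; ring
        have h5 : Real.exp (-β * u ^ 2 / 2) ≤ 1 := Real.exp_le_one_iff.2 (by
          have : 0 ≤ β * u ^ 2 := by positivity
          linarith)
        have h6 : (b - β) * u ^ 2 / 2 ≤ c ^ 2 * |b - β| := by
          have h7 : (b - β) * u ^ 2 ≤ |b - β| * c ^ 2 :=
            mul_le_mul (le_abs_self _) hu2 (sq_nonneg u) (abs_nonneg _)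
          have h8 : 0 ≤ |b - β| * c ^ 2 := by positivity
          linarith
        have h9 : 0 ≤ c ^ 2 * |b - β| := by positivity
        have h10 : 1 - c ^ 2 * |b - β| ≤ Real.exp (-b * u ^ 2 / 2 - -β * u ^ 2 / 2) := by linarith
        rw [h4]
        nlinarith [mul_le_mul_of_nonneg_left h10 (Real.exp_pos (-β * u ^ 2 / 2)).le,
          mul_le_mul_of_nonneg_right h5 h9]
      have h11 := mul_le_mul_of_nonneg_left h2 hA0.le
      have h12 : (A - ratioAmp n (k n)) * Real.exp (-b * u ^ 2 / 2) ≤ |ratioAmp n (k n) - A| := by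
        rw [abs_sub_comm]
        exact (mul_le_mul_of_nonneg_right (le_abs_self _) (Real.exp_pos _).le).trans
          (mul_le_of_le_one_right (abs_nonneg _) h1)
      simp only [hδ]
      linarith
    · have hgu : g u = 0 := by
        refine max_eq_right (sub_nonpos.2 ?_)
        rw [hAexp, Real.exp_le_one_iff]
        have hu2 : c ^ 2 ≤ u ^ 2 :=
          sq_le_sq.2 ((abs_of_nonneg hc0).le.trans (not_le.1 hu).le)
        have := mul_le_mul_of_nonneg_left hu2 hβ0.le
        rw [hc2, mul_div_cancel₀ _ hβ0.ne'] at this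
        linarith
      rw [hgu]
      linarith
  refine ⟨fun n => min (D n - phi α) 0, ?_, fun n => ?_⟩
  · refine squeeze_zero_norm' ?_ (by simpa using hrl.abs)
    filter_upwards [hlow] with n h1
    rw [Real.norm_eq_abs, abs_of_nonpos (min_le_right _ _), neg_le]
    exact le_min ((neg_abs_le _).trans h1) (neg_nonpos.2 (abs_nonneg _))
  · linarith [min_le_left (D n - phi α) 0]

end Asymptotics

end FiniteDeFinetti

end

theorem mainTheorem5 :
    ∃ Ψ : (n : ℕ) → FiniteDeFinetti.TensorSpace 2 n,
      (∀ n : ℕ, Ψ n ∈ FiniteDeFinetti.Sym 2 n ∧ ‖Ψ n‖ = 1) ∧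
      (∀ (k : ℕ → ℕ) (hk : ∀ n, k n ≤ n),
        Filter.Tendsto k Filter.atTop Filter.atTop →
        Asymptotics.IsLittleO Filter.atTop (fun n : ℕ => (k n : ℝ)) (fun n : ℕ => (n : ℝ)) →
        ∃ e : ℕ → ℝ,
          Asymptotics.IsLittleO Filter.atTop e (fun n : ℕ => (k n : ℝ) / (n : ℝ)) ∧
          ∀ n : ℕ,
            1 / √(2 * Real.pi * Real.exp 1) * ((k n : ℝ) / (n : ℝ)) + e n ≤
              FiniteDeFinetti.distTo
                (FiniteDeFinetti.partialTrace (hk n) (FiniteDeFinetti.proj (Ψ n)))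
                (FiniteDeFinetti.productMixtures 2 (k n))) ∧
      (∀ (α : ℝ) (k : ℕ → ℕ) (hk : ∀ n, k n ≤ n), 0 < α → α < 1 / 2 →
        Filter.Tendsto (fun n : ℕ => (k n : ℝ) / (n : ℝ)) Filter.atTop (nhds α) →
        ∃ e : ℕ → ℝ,
          Filter.Tendsto e Filter.atTop (nhds 0) ∧
          ∀ n : ℕ,
            FiniteDeFinetti.phi α + e n ≤
              FiniteDeFinetti.distTo
                (FiniteDeFinetti.partialTrace (hk n) (FiniteDeFinetti.proj (Ψ n)))
                (FiniteDeFinetti.productMixtures 2 (k n))) :=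
  ⟨FiniteDeFinetti.balancedState,
    fun n => ⟨FiniteDeFinetti.balancedState_mem_Sym n, FiniteDeFinetti.norm_balancedState n⟩,
    fun _ hk hktop hko => FiniteDeFinetti.exists_isLittleO_bound_distTo hk hktop
      hko.tendsto_div_nhds_zero,
    fun _ _ hk hα0 hα1 hα => FiniteDeFinetti.exists_tendsto_bound_distTo hk hα0
      (hα1.trans (by norm_num)) hα⟩
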